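/- Let $D$ be an integral domain with quotient field $K$. For a nonzero fractional ideal $I$ of $D$ put $I^{-1}=\{x\in K\mid xI\subseteq D\}$, $I_v=(I^{-1})^{-1}$, and $I_t=\bigcup_H H_v$, where $H$ ranges over the nonzero finitely generated fractional ideals contained in $I$. A nonzero ideal $I$ of $D$ is a $t$-ideal if $I_t=I$; a maximal $t$-ideal is a maximal element of the set of proper $t$-ideals of $D$ (it is always a prime ideal). The domain $D$ is called $t$-sharp if, whenever $I,A,B$ are nonzero ideals of $D$ with $I\supseteq AB$, there exist nonzero ideals $H,J$ of $D$ such that $I_t=(HJ)_t$, $H_t\supseteq A$ and $J_t\supseteq B$. Suppose that $D$ is $t$-sharp. Then: (1) $D$ is a PVMD (Prüfer $v$-multiplication domain), that is, $(II^{-1})_t=D$ for every nonzero finitely generated ideal $I$ of $D$; (2) the $t$-dimension of $D$, that is, $\sup\{n\mid \text{there is a chain } 0\subset P_1\subset\cdots\subset P_n \text{ of prime } t\text{-ideals } P_i \text{ of } D\}$ with strict inclusions, is at most $1$; (3) for every maximal $t$-ideal $M$ of $D$, the localization $D_M$ is a valuation domain whose value group is isomorphic, as an ordered group, to a complete subgroup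 of the additive group $\mathbb{R}$. -/

import Mathlib

open scoped nonZeroDivisors

noncomputable section

section StarOperations

variable {D : Type*} [CommRing D] [IsDomain D] {K : Type*} [Field K] [Algebra D K]
  [IsFractionRing D K]

/-- The `v`-closure `I_v = (I⁻¹)⁻¹` of a fractional ideal. -/
def vClosure (I : FractionalIdeal D⁰ K) : FractionalIdeal D⁰ K := (I⁻¹)⁻¹

theorem inv_ne_zero_of_ne_zero {I : FractionalIdeal D⁰ K} (hI : I ≠ 0) : I⁻¹ ≠ 0 := by
  obtain ⟨a, ha, h⟩ := I.isFractional
  intro h0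
  have hmem : algebraMap D K a ∈ I⁻¹ := by
    rw [FractionalIdeal.mem_inv_iff hI]
    intro y hy
    obtain ⟨d, hd⟩ := h y hy
    rw [FractionalIdeal.mem_one_iff]
    exact ⟨d, by rw [hd, Algebra.smul_def]⟩
  rw [h0, FractionalIdeal.mem_zero_iff] at hmem
  exact nonZeroDivisors.ne_zero ha
    ((IsFractionRing.injective D K) (by rw [hmem, map_zero]))

theorem vClosure_mono {I J : FractionalIdeal D⁰ K} (h : I ≤ J) : vClosure I ≤ vClosure J := by
  by_cases hI : I = 0
  · have h0 : vClosure I = 0 := by simp only [vClosure, hI, FractionalIdeal.inv_zero']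
    rw [h0]
    exact FractionalIdeal.zero_le _
  · have hJ : J ≠ 0 := by
      rintro rfl
      exact hI (le_antisymm h (FractionalIdeal.zero_le I))
    exact FractionalIdeal.inv_anti_mono (inv_ne_zero_of_ne_zero hJ) (inv_ne_zero_of_ne_zero hI)
      (FractionalIdeal.inv_anti_mono hI hJ h)

/-- The `t`-closure `I_t = ⋃ H_v`, where `H` ranges over the finitely generated fractional ideals
contained in `I`. Allowing `H = 0` (with `0_v = 0`) adds nothing when `I ≠ 0` and gives
`0_t = 0`. -/
def tClosure (I : FractionalIdeal D⁰ K) : FractionalIdeal D⁰ K :=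
  ⟨{ carrier := {x | ∃ H : FractionalIdeal D⁰ K, (H : Submodule D K).FG ∧ H ≤ I ∧ x ∈ vClosure H}
     zero_mem' := ⟨0, by simpa using Submodule.fg_bot, FractionalIdeal.zero_le I,
       Submodule.zero_mem (vClosure (0 : FractionalIdeal D⁰ K) : Submodule D K)⟩
     add_mem' := by
       rintro x y ⟨H, hH, hHI, hx⟩ ⟨J, hJ, hJI, hy⟩
       refine ⟨H ⊔ J, by simpa using hH.sup hJ, sup_le hHI hJI, ?_⟩
       exact Submodule.add_mem (vClosure (H ⊔ J) : Submodule D K)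
         (vClosure_mono le_sup_left hx) (vClosure_mono le_sup_right hy)
     smul_mem' := by
       rintro c x ⟨H, hH, hHI, hx⟩
       exact ⟨H, hH, hHI, Submodule.smul_mem (vClosure H : Submodule D K) c hx⟩ },
   by
     obtain ⟨a, ha, h⟩ := (vClosure I).isFractional
     refine ⟨a, ha, ?_⟩
     rintro x ⟨H, -, hHI, hx⟩
     exact h x (vClosure_mono hHI hx)⟩

end StarOperations

section Domains

variable (D : Type*) [CommRing D] [IsDomain D] (K : Type*) [Field K] [Algebra D K]
  [IsFractionRing D K]

/-- A domain `D` with quotient field `K` is `t`-sharp if, whenever `I ⊇ AB` with `I, A, B` nonzero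
ideals of `D`, there are nonzero ideals `H, J` of `D` with `I_t = (HJ)_t`, `H_t ⊇ A` and
`J_t ⊇ B`. -/
def IsTSharp : Prop :=
  ∀ I A B : Ideal D, I ≠ ⊥ → A ≠ ⊥ → B ≠ ⊥ → A * B ≤ I →
    ∃ H J : Ideal D, H ≠ ⊥ ∧ J ≠ ⊥ ∧
      tClosure (I : FractionalIdeal D⁰ K) = tClosure ((H * J : Ideal D) : FractionalIdeal D⁰ K) ∧
      (A : FractionalIdeal D⁰ K) ≤ tClosure (H : FractionalIdeal D⁰ K) ∧
      (B : FractionalIdeal D⁰ K) ≤ tClosure (J : FractionalIdeal D⁰ K)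

/-- Prüfer `v`-multiplication domain: every nonzero finitely generated ideal `I` is
`t`-invertible, i.e. `(I I⁻¹)_t = D`. -/
def IsPVMD : Prop :=
  ∀ I : Ideal D, I.FG → I ≠ ⊥ →
    tClosure ((I : FractionalIdeal D⁰ K) * (I : FractionalIdeal D⁰ K)⁻¹) = 1

variable {D}

/-- A (nonzero, integral) `t`-ideal of `D`. -/
def IsTIdeal (I : Ideal D) : Prop :=
  I ≠ ⊥ ∧ tClosure (I : FractionalIdeal D⁰ K) = (I : FractionalIdeal D⁰ K)

/-- A maximal `t`-ideal: maximal among the proper integral `t`-ideals. -/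
def IsMaximalTIdeal (M : Ideal D) : Prop :=
  Maximal (fun I : Ideal D => IsTIdeal K I ∧ I ≠ ⊤) M

variable (D)

/-- The `t`-dimension: the supremum of the `n` for which there is a chain
`0 ⊂ P₁ ⊂ ⋯ ⊂ Pₙ` with every `Pᵢ` a prime `t`-ideal. -/
def tDimension : ℕ∞ :=
  ⨆ (n : ℕ) (_ : ∃ P : Fin n → Ideal D,
    StrictMono P ∧ ∀ i, (P i).IsPrime ∧ IsTIdeal K (P i)), (n : ℕ∞)

end Domains

/-- The value group of the valuation domain `V` is, as an ordered group, a complete subgroup of the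
reals. `ValuationRing.ValueGroup` is the value group with a zero adjoined, written
multiplicatively, and its units form the value group itself. (Its order is the reverse of that of
the additive value group, which is immaterial because a subgroup `H` of `ℝ` is stable under
negation.) -/
def HasCompleteRealValueGroup (V : Type*) [CommRing V] [IsDomain V] [ValuationRing V] : Prop :=
  ∃ H : AddSubgroup ℝ, IsComplete (H : Set ℝ) ∧
    Nonempty ((ValuationRing.ValueGroup V (FractionRing V))ˣ ≃*o Multiplicative H)

end

/-! ### Formal properties of the `v`- and `t`-closures. -/

section Closures

variable {D : Type*} [CommRing D] [IsDomain D] {K : Type*} [Field K] [Algebra D K]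
  [IsFractionRing D K]

/-! Everything comes from applying sharpness to a principal ideal. Take `0 ≠ d ∈ A` and `B = (d) :
A`, so that `AB ⊆ (d)` and `(d) = (HJ)_t` with `A ⊆ H_t`, `B ⊆ J_t`. For `A` finitely generated this
forces `d⁻¹J ⊆ A⁻¹` and `H ⊆ A_t`, hence `1 ∈ (AA⁻¹)_t`: `D` is a PVMD.

At a prime `t`-ideal `P`, the ring `V = D_P` is then a valuation domain. Passing to `I_t` does not
change the extension of `I` to `V`, so `V` is sharp for ordinary ideal products. The same choice of
`B` in `V`, now with `A` an arbitrary nonzero ideal, gives a gcd for `A`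
(`hasIdealGCDs_of_exists_mul`).

Such gcds are suprema in the value group. They exclude nonzero nonmaximal primes, which bounds the
`t`-dimension. They also make the value group Archimedean, so it embeds in `ℝ` with cyclic or dense
image, and a dense image with suprema is all of `ℝ`. -/

theorem vClosure_zero : vClosure (0 : FractionalIdeal D⁰ K) = 0 := by
  simp only [vClosure, FractionalIdeal.inv_zero']

theorem mem_vClosure_iff {F : FractionalIdeal D⁰ K} (hF : F ≠ 0) {x : K} :
    x ∈ vClosure F ↔
      ∀ y : K, (∀ z ∈ F, y * z ∈ (1 : FractionalIdeal D⁰ K)) →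
        x * y ∈ (1 : FractionalIdeal D⁰ K) := by
  rw [vClosure, FractionalIdeal.mem_inv_iff (inv_ne_zero_of_ne_zero hF)]
  exact forall_congr' fun y => by rw [FractionalIdeal.mem_inv_iff hF]

theorem mul_mem_one_of_mem_vClosure {F : FractionalIdeal D⁰ K} {x y : K} (hx : x ∈ vClosure F)
    (hy : ∀ z ∈ F, y * z ∈ (1 : FractionalIdeal D⁰ K)) :
    x * y ∈ (1 : FractionalIdeal D⁰ K) := by
  by_cases hF : F = 0
  · rw [hF, vClosure_zero, FractionalIdeal.mem_zero_iff] at hx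
    rw [hx, zero_mul]
    exact Submodule.zero_mem ((1 : FractionalIdeal D⁰ K) : Submodule D K)
  · exact (mem_vClosure_iff hF).mp hx y hy

theorem le_vClosure (F : FractionalIdeal D⁰ K) : F ≤ vClosure F := by
  by_cases hF : F = 0
  · rw [hF]; exact FractionalIdeal.zero_le _
  · intro x hx
    refine (mem_vClosure_iff hF).mpr fun y hy => ?_
    rw [mul_comm]
    exact hy x hx

theorem mul_mem_vClosure {F G : FractionalIdeal D⁰ K} {c x : K} (h : ∀ z ∈ F, c * z ∈ G)
    (hx : x ∈ vClosure F) : c * x ∈ vClosure G := by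
  by_cases hG : G = 0
  · subst hG
    by_cases hc : c = 0
    · rw [hc, zero_mul]
      exact Submodule.zero_mem (vClosure (0 : FractionalIdeal D⁰ K) : Submodule D K)
    · have hF : F = 0 := by
        refine FractionalIdeal.eq_zero_iff.mpr fun z hz => ?_
        have := (FractionalIdeal.mem_zero_iff D⁰).mp (h z hz)
        exact (mul_eq_zero.mp this).resolve_left hc
      rw [hF, vClosure_zero, FractionalIdeal.mem_zero_iff] at hx
      rw [hx, mul_zero]
      exact Submodule.zero_mem (vClosure (0 : FractionalIdeal D⁰ K) : Submodule D K)
  · refine (mem_vClosure_iff hG).mpr fun y hy => ?_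
    have := mul_mem_one_of_mem_vClosure (y := y * c) hx fun z hz => by
      rw [mul_assoc]; exact hy _ (h z hz)
    convert this using 1
    ring

theorem vClosure_vClosure_le (F : FractionalIdeal D⁰ K) : vClosure (vClosure F) ≤ vClosure F := by
  by_cases hF : F = 0
  · rw [hF, vClosure_zero, vClosure_zero]
  · intro x hx
    refine (mem_vClosure_iff hF).mpr fun y hy => ?_
    refine mul_mem_one_of_mem_vClosure hx fun z hz => ?_
    rw [mul_comm]
    exact mul_mem_one_of_mem_vClosure hz hy

theorem mem_tClosure {I : FractionalIdeal D⁰ K} {x : K} :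
    x ∈ tClosure I ↔
      ∃ H : FractionalIdeal D⁰ K, (H : Submodule D K).FG ∧ H ≤ I ∧ x ∈ vClosure H :=
  Iff.rfl

theorem mul_mem_one_of_mem_tClosure {I : FractionalIdeal D⁰ K} {x y : K} (hx : x ∈ tClosure I)
    (hy : ∀ z ∈ I, y * z ∈ (1 : FractionalIdeal D⁰ K)) :
    x * y ∈ (1 : FractionalIdeal D⁰ K) := by
  obtain ⟨H, -, hHI, hx⟩ := hx
  exact mul_mem_one_of_mem_vClosure hx fun z hz => hy z (hHI hz)

theorem le_tClosure (I : FractionalIdeal D⁰ K) : I ≤ tClosure I := by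
  intro x hx
  refine mem_tClosure.mpr ⟨FractionalIdeal.spanSingleton D⁰ x, ?_, ?_, ?_⟩
  · rw [FractionalIdeal.coe_spanSingleton]
    exact Submodule.fg_span_singleton x
  · exact FractionalIdeal.spanSingleton_le_iff_mem.mpr hx
  · exact le_vClosure _ (FractionalIdeal.mem_spanSingleton_self D⁰ x)

theorem mul_mem_tClosure {I J : FractionalIdeal D⁰ K} {c x : K} (h : ∀ z ∈ I, c * z ∈ J)
    (hx : x ∈ tClosure I) : c * x ∈ tClosure J := by
  obtain ⟨H, hH, hHI, hx⟩ := hx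
  refine mem_tClosure.mpr ⟨FractionalIdeal.spanSingleton D⁰ c * H, ?_, ?_, ?_⟩
  · rw [FractionalIdeal.coe_mul, FractionalIdeal.coe_spanSingleton]
    exact (Submodule.fg_span_singleton c).mul hH
  · exact FractionalIdeal.spanSingleton_mul_le_iff.mpr fun z hz => h z (hHI hz)
  · exact mul_mem_vClosure
      (fun z hz => FractionalIdeal.mem_singleton_mul.mpr ⟨z, hz, rfl⟩) hx

theorem tClosure_mono {I J : FractionalIdeal D⁰ K} (h : I ≤ J) : tClosure I ≤ tClosure J := by
  rintro x ⟨H, hH, hHI, hx⟩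
  exact ⟨H, hH, hHI.trans h, hx⟩

theorem tClosure_le_one {I : FractionalIdeal D⁰ K} (h : I ≤ 1) : tClosure I ≤ 1 := by
  intro x hx
  have := mul_mem_one_of_mem_tClosure (y := 1) hx fun z hz => by rw [one_mul]; exact h hz
  rwa [mul_one] at this

/-- Finitely many elements of `I_t` share one witness `H`; this is what makes the `t`-closure
idempotent. -/
theorem exists_fg_le_vClosure {I : FractionalIdeal D⁰ K} (S : Submodule D K) (hS : S.FG)
    (hSI : ∀ x ∈ S, x ∈ tClosure I) :
    ∃ H : FractionalIdeal D⁰ K, (H : Submodule D K).FG ∧ H ≤ I ∧ ∀ x ∈ S, x ∈ vClosure H := by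
  induction S, hS using Submodule.fg_induction with
  | singleton x =>
    obtain ⟨H, hH, hHI, hx⟩ := hSI x (Submodule.mem_span_singleton_self x)
    refine ⟨H, hH, hHI, fun y hy => ?_⟩
    have : Submodule.span D {x} ≤ (vClosure H : Submodule D K) :=
      (Submodule.span_singleton_le_iff_mem _ _).mpr hx
    exact this hy
  | sup S T hS hT ihS ihT =>
    obtain ⟨H, hH, hHI, hx⟩ := ihS fun x hx => hSI x (le_sup_left (a := S) hx)
    obtain ⟨J, hJ, hJI, hy⟩ := ihT fun x hx => hSI x (le_sup_right (a := S) hx)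
    refine ⟨H ⊔ J, by simpa using hH.sup hJ, sup_le hHI hJI, fun z hz => ?_⟩
    obtain ⟨x, hxS, y, hyT, rfl⟩ := Submodule.mem_sup.mp hz
    exact Submodule.add_mem (vClosure (H ⊔ J) : Submodule D K)
      (vClosure_mono le_sup_left (hx x hxS)) (vClosure_mono le_sup_right (hy y hyT))

theorem tClosure_tClosure (I : FractionalIdeal D⁰ K) : tClosure (tClosure I) = tClosure I := by
  refine le_antisymm ?_ (le_tClosure _)
  rintro x ⟨F, hF, hFI, hx⟩
  obtain ⟨H, hH, hHI, h⟩ := exists_fg_le_vClosure (F : Submodule D K) hF fun x hx => hFI hx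
  exact mem_tClosure.mpr ⟨H, hH, hHI,
    vClosure_vClosure_le _ (vClosure_mono (fun z hz => h z hz) hx)⟩

end Closures

/-! ### The PVMD property and prime `t`-ideals. -/

section TSharp

variable {D : Type*} [CommRing D] [IsDomain D] {K : Type*} [Field K] [Algebra D K]
  [IsFractionRing D K]

theorem IsTSharp.isPVMD (hD : IsTSharp D K) : IsPVMD D K := by
  intro A hA hA0
  obtain ⟨d, hdA, hd0⟩ := Submodule.exists_mem_ne_zero_of_ne_bot hA0
  have hAK : (A : FractionalIdeal D⁰ K) ≠ 0 := FractionalIdeal.coeIdeal_ne_zero.mpr hA0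
  have hdK : algebraMap D K d ≠ 0 :=
    (map_ne_zero_iff _ (IsFractionRing.injective D K)).mpr hd0
  set δ := algebraMap D K d with hδ
  set B : Ideal D := (Ideal.span {d}).colon (A : Set D) with hB
  have hB0 : B ≠ ⊥ := by
    refine (Submodule.ne_bot_iff _).mpr ⟨d, ?_, hd0⟩
    exact Submodule.mem_colon.mpr fun s _ =>
      Ideal.mul_mem_right _ _ (Ideal.mem_span_singleton_self d)
  have hAB : A * B ≤ Ideal.span {d} := Ideal.mul_le.mpr fun a ha b hb => by
    rw [mul_comm]
    exact Submodule.mem_colon.mp hb a ha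
  obtain ⟨H, J, -, -, hHJ, hAH, hBJ⟩ :=
    hD (Ideal.span {d}) A B (by simpa using hd0) hA0 hB0 hAB
  rw [FractionalIdeal.coeIdeal_span_singleton, FractionalIdeal.coeIdeal_mul] at hHJ
  have hdHJ : δ ∈ tClosure ((H : FractionalIdeal D⁰ K) * (J : FractionalIdeal D⁰ K)) :=
    hHJ ▸ le_tClosure _ (FractionalIdeal.mem_spanSingleton_self _ _)
  have hHJd : ∀ h ∈ (H : FractionalIdeal D⁰ K), ∀ j ∈ (J : FractionalIdeal D⁰ K),
      h * j * δ⁻¹ ∈ (1 : FractionalIdeal D⁰ K) := by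
    intro h hh j hj
    have hm : h * j ∈ tClosure (FractionalIdeal.spanSingleton D⁰ δ) :=
      hHJ ▸ le_tClosure _ (FractionalIdeal.mul_mem_mul hh hj)
    refine mul_mem_one_of_mem_tClosure hm fun z hz => ?_
    obtain ⟨c, rfl⟩ := (FractionalIdeal.mem_spanSingleton _).mp hz
    rw [Algebra.smul_def, mul_left_comm, inv_mul_cancel₀ hdK, mul_one]
    exact (FractionalIdeal.mem_one_iff _).mpr ⟨c, rfl⟩
  have hJA : ∀ j ∈ (J : FractionalIdeal D⁰ K), j * δ⁻¹ ∈ (A : FractionalIdeal D⁰ K)⁻¹ := by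
    intro j hj
    refine (FractionalIdeal.mem_inv_iff hAK).mpr fun a ha => ?_
    rw [mul_comm]
    refine mul_mem_one_of_mem_tClosure (hAH ha) fun h hh => ?_
    convert hHJd h hh j hj using 1
    ring
  -- As `A` is finitely generated, `A` itself can serve as the witness, so `H ⊆ A_v` suffices. For
  -- `y ∈ A⁻¹`, `yδ` lies in `B ⊆ J_t`, and `HJ ⊆ (d)` gives `hy ∈ D`.
  have hHA : ∀ h ∈ (H : FractionalIdeal D⁰ K), h ∈ tClosure (A : FractionalIdeal D⁰ K) := by
    intro h hh
    refine mem_tClosure.mpr ⟨A, ?_, le_rfl, (mem_vClosure_iff hAK).mpr fun y hy => ?_⟩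
    · exact (FractionalIdeal.coeIdeal_fg D⁰ (IsFractionRing.injective D K) A).mpr hA
    · obtain ⟨b, hb⟩ := (FractionalIdeal.mem_one_iff _).mp
        (hy δ (FractionalIdeal.mem_coeIdeal_of_mem D⁰ hdA))
      have hbB : b ∈ B := Submodule.mem_colon.mpr fun a ha => by
        obtain ⟨c, hc⟩ := (FractionalIdeal.mem_one_iff _).mp
          (hy _ (FractionalIdeal.mem_coeIdeal_of_mem D⁰ ha))
        refine Ideal.mem_span_singleton.mpr ⟨c, IsFractionRing.injective D K ?_⟩
        rw [smul_eq_mul, map_mul, map_mul, hb, hc, ← hδ]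
        ring
      have hbJ := hBJ (FractionalIdeal.mem_coeIdeal_of_mem D⁰ hbB)
      have := mul_mem_one_of_mem_tClosure (y := h * δ⁻¹) hbJ fun j hj => by
        convert hHJd h hh j hj using 1
        ring
      rw [hb] at this
      convert this using 1
      field_simp
  have hmain : ∀ z ∈ (H : FractionalIdeal D⁰ K) * (J : FractionalIdeal D⁰ K),
      δ⁻¹ * z ∈ tClosure ((A : FractionalIdeal D⁰ K) * (A : FractionalIdeal D⁰ K)⁻¹) := by
    intro z hz
    refine FractionalIdeal.mul_induction_on hz (fun h hh j hj => ?_) fun x y hx hy => ?_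
    · have : (j * δ⁻¹) * h ∈
          tClosure ((A : FractionalIdeal D⁰ K) * (A : FractionalIdeal D⁰ K)⁻¹) :=
        mul_mem_tClosure (fun a ha => by
          rw [mul_comm _ a]
          exact FractionalIdeal.mul_mem_mul ha (hJA j hj)) (hHA h hh)
      convert this using 1
      ring
    · rw [mul_add]
      exact Submodule.add_mem (tClosure _ : FractionalIdeal D⁰ K).val hx hy
  have hone := mul_mem_tClosure hmain hdHJ
  rw [inv_mul_cancel₀ hdK, tClosure_tClosure] at hone
  refine le_antisymm (tClosure_le_one ?_) (FractionalIdeal.one_le.mpr hone)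
  exact FractionalIdeal.mul_one_div_le_one

/-- Any two elements become comparable under divisibility after inverting the complement of a
prime `t`-ideal of a PVMD. -/
theorem IsPVMD.exists_mul_eq_mul (hD : IsPVMD D K) {P : Ideal D} (hP : P.IsPrime)
    (hPt : IsTIdeal K P) (a b : D) : ∃ u w : D, u * b = w * a ∧ (u ∉ P ∨ w ∉ P) := by
  have h1 : (1 : D) ∉ P := fun h => hP.ne_top ((Ideal.eq_top_iff_one P).mpr h)
  by_cases ha0 : a = 0
  · exact ⟨0, 1, by simp [ha0], Or.inr h1⟩
  have haK : algebraMap D K a ≠ 0 :=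
    (map_ne_zero_iff _ (IsFractionRing.injective D K)).mpr ha0
  set A : Ideal D := Ideal.span {a, b} with hA
  have haA : a ∈ A := Ideal.subset_span (by simp)
  have hbA : b ∈ A := Ideal.subset_span (by simp)
  have hA0 : A ≠ ⊥ := (Submodule.ne_bot_iff _).mpr ⟨a, haA, ha0⟩
  have hAK : (A : FractionalIdeal D⁰ K) ≠ 0 := FractionalIdeal.coeIdeal_ne_zero.mpr hA0
  have ht := hD A (Submodule.fg_span (Set.toFinite _)) hA0
  -- Some `iy` with `i = ra + sb`, `y ∈ A⁻¹` avoids `P`. With `u = ya`, `w = yb` it equals `ru +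
  -- sw`, so `u` and `w` are not both in `P`.
  have hnot : ¬ (A : FractionalIdeal D⁰ K) * (A : FractionalIdeal D⁰ K)⁻¹ ≤ P := by
    intro hle
    have := tClosure_mono hle
    rw [ht, hPt.2] at this
    exact hP.ne_top (top_le_iff.mp ((FractionalIdeal.coeIdeal_le_coeIdeal K).mp this))
  rw [FractionalIdeal.mul_le] at hnot
  push Not at hnot
  obtain ⟨i, hi, y, hy, hiy⟩ := hnot
  rw [FractionalIdeal.mem_inv_iff hAK] at hy
  obtain ⟨u, hu⟩ := (FractionalIdeal.mem_one_iff _).mp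
    (hy _ (FractionalIdeal.mem_coeIdeal_of_mem D⁰ haA))
  obtain ⟨w, hw⟩ := (FractionalIdeal.mem_one_iff _).mp
    (hy _ (FractionalIdeal.mem_coeIdeal_of_mem D⁰ hbA))
  refine ⟨u, w, IsFractionRing.injective D K ?_, ?_⟩
  · rw [map_mul, map_mul, hu, hw]
    ring
  · by_contra! huw
    obtain ⟨i₁, hi₁, rfl⟩ := (FractionalIdeal.mem_coeIdeal _).mp hi
    obtain ⟨r, s, rfl⟩ := Ideal.mem_span_pair.mp hi₁
    refine hiy ((FractionalIdeal.mem_coeIdeal _).mpr ⟨r * u + s * w,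
      P.add_mem (P.mul_mem_left _ huw.1) (P.mul_mem_left _ huw.2), ?_⟩)
    simp only [map_add, map_mul, hu, hw]
    ring

/-- If `a ∉ M`, maximality forces `(M + aD)_t = D`. Multiplying by `b` sends `M + aD` into `M`,
hence `1` to `b ∈ M_t = M`. -/
theorem IsMaximalTIdeal.isPrime {M : Ideal D} (hM : IsMaximalTIdeal K M) : M.IsPrime := by
  refine ⟨hM.prop.2, fun {a b} hab => or_iff_not_imp_left.mpr fun ha => ?_⟩
  obtain ⟨N, hN⟩ := FractionalIdeal.le_one_iff_exists_coeIdeal.mp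
    (tClosure_le_one (FractionalIdeal.coeIdeal_le_one (S := D⁰) (P := K)
      (I := M ⊔ Ideal.span {a})))
  have hle : M ⊔ Ideal.span {a} ≤ N := by
    rw [← FractionalIdeal.coeIdeal_le_coeIdeal K, hN]
    exact le_tClosure _
  have hMN : M ≤ N := le_sup_left.trans hle
  have hNt : IsTIdeal K N :=
    ⟨fun h => hM.prop.1.1 (le_bot_iff.mp (h ▸ hMN)), by rw [hN, tClosure_tClosure]⟩
  have haN : a ∈ N := hle (le_sup_right (a := M) (Ideal.mem_span_singleton_self a))
  have htop : N = ⊤ := by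
    by_contra hne
    exact ha (hM.le_of_ge ⟨hNt, hne⟩ hMN haN)
  have hone : (1 : K) ∈ tClosure ((M ⊔ Ideal.span {a} : Ideal D) : FractionalIdeal D⁰ K) := by
    rw [← hN, htop]
    exact (FractionalIdeal.mem_one_iff _).mpr ⟨1, map_one _⟩
  have := mul_mem_tClosure (c := algebraMap D K b) (J := (M : FractionalIdeal D⁰ K)) ?_ hone
  · rw [mul_one, hM.prop.1.2] at this
    obtain ⟨b₁, hb₁, h⟩ := (FractionalIdeal.mem_coeIdeal _).mp this
    exact IsFractionRing.injective D K h ▸ hb₁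
  · intro z hz
    obtain ⟨x, hx, rfl⟩ := (FractionalIdeal.mem_coeIdeal _).mp hz
    rw [← map_mul]
    refine FractionalIdeal.mem_coeIdeal_of_mem _ ?_
    obtain ⟨m, hm, y, hy, rfl⟩ := Submodule.mem_sup.mp hx
    obtain ⟨c, rfl⟩ := Ideal.mem_span_singleton.mp hy
    rw [mul_add]
    refine M.add_mem (M.mul_mem_left _ hm) ?_
    rw [show b * (a * c) = c * (a * b) by ring]
    exact M.mul_mem_left _ hab

end TSharp

/-! ### Localization at a prime `t`-ideal, and gcds of ideals. -/

section Localization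

variable {D : Type*} [CommRing D] [IsDomain D] {K : Type*} [Field K] [Algebra D K]
  [IsFractionRing D K]

/-- Finitely generated ideals become principal at `P`, here with a common denominator `s`. -/
theorem exists_forall_dvd_mul_of_fg {D : Type*} [CommRing D] {P : Ideal D} (hP : P.IsPrime)
    (h : ∀ a b : D, ∃ u w : D, u * b = w * a ∧ (u ∉ P ∨ w ∉ P)) (I : Ideal D) (hI : I.FG) :
    ∃ a ∈ I, ∃ s ∉ P, ∀ z ∈ I, a ∣ s * z := by
  induction I, hI using Submodule.fg_induction with
  | singleton x =>
    refine ⟨x, Submodule.mem_span_singleton_self x, 1,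
      fun h => hP.ne_top ((Ideal.eq_top_iff_one P).mpr h), fun z hz => ?_⟩
    rw [one_mul]
    exact Ideal.mem_span_singleton.mp hz
  | sup S T _ _ ihS ihT =>
    obtain ⟨a, ha, s, hs, hS⟩ := ihS
    obtain ⟨b, hb, t, ht, hT⟩ := ihT
    obtain ⟨u, w, huw, hu | hw⟩ := h a b
    · refine ⟨a, le_sup_left (a := S) ha, s * u * t,
        hP.mul_notMem (hP.mul_notMem hs hu) ht, fun z hz => ?_⟩
      obtain ⟨x, hx, y, hy, rfl⟩ := Submodule.mem_sup.mp hz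
      obtain ⟨c, hc⟩ := hS x hx
      obtain ⟨e, he⟩ := hT y hy
      exact ⟨u * t * c + s * w * e, by
        linear_combination u * t * hc + s * u * he + s * e * huw⟩
    · refine ⟨b, le_sup_right (a := S) hb, s * w * t,
        hP.mul_notMem (hP.mul_notMem hs hw) ht, fun z hz => ?_⟩
      obtain ⟨x, hx, y, hy, rfl⟩ := Submodule.mem_sup.mp hz
      obtain ⟨c, hc⟩ := hS x hx
      obtain ⟨e, he⟩ := hT y hy
      exact ⟨t * u * c + s * w * e, by
        linear_combination w * t * hc + s * w * he - t * c * huw⟩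

/-- The `t`-closure is invisible at `P`: if `x ∈ J_v` with `J ⊆ I` finitely generated and `sJ ⊆ aD`,
`a ∈ J`, then `s/a ∈ J⁻¹`, so `sx ∈ aD ⊆ I`. -/
theorem exists_mul_mem_of_mem_tClosure {P : Ideal D} (hP : P.IsPrime)
    (h : ∀ a b : D, ∃ u w : D, u * b = w * a ∧ (u ∉ P ∨ w ∉ P)) {I : Ideal D} {x : D}
    (hx : algebraMap D K x ∈ tClosure (I : FractionalIdeal D⁰ K)) : ∃ s ∉ P, s * x ∈ I := by
  obtain ⟨F, hF, hFI, hx⟩ := hx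
  obtain ⟨J, rfl⟩ := FractionalIdeal.le_one_iff_exists_coeIdeal.mp
    (hFI.trans FractionalIdeal.coeIdeal_le_one)
  rw [FractionalIdeal.coeIdeal_le_coeIdeal] at hFI
  obtain ⟨a, ha, s, hs, hdvd⟩ := exists_forall_dvd_mul_of_fg hP h J
    ((FractionalIdeal.coeIdeal_fg D⁰ (IsFractionRing.injective D K) J).mp hF)
  have hs0 : s ≠ 0 := fun h0 => hs (h0 ▸ P.zero_mem)
  refine ⟨s, hs, ?_⟩
  by_cases ha0 : a = 0
  · have hJ : J = ⊥ := (Submodule.eq_bot_iff _).mpr fun z hz => by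
      have := hdvd z hz
      rw [ha0, zero_dvd_iff] at this
      exact (mul_eq_zero.mp this).resolve_left hs0
    rw [hJ, FractionalIdeal.coeIdeal_bot, vClosure_zero, FractionalIdeal.mem_zero_iff,
      map_eq_zero_iff _ (IsFractionRing.injective D K)] at hx
    rw [hx, mul_zero]
    exact I.zero_mem
  · have haK : algebraMap D K a ≠ 0 :=
      (map_ne_zero_iff _ (IsFractionRing.injective D K)).mpr ha0
    have := mul_mem_one_of_mem_vClosure (y := algebraMap D K s / algebraMap D K a) hx
      fun z hz => by
        obtain ⟨x, hx, rfl⟩ := (FractionalIdeal.mem_coeIdeal _).mp hz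
        obtain ⟨c, hc⟩ := hdvd x hx
        refine (FractionalIdeal.mem_one_iff _).mpr ⟨c, ?_⟩
        rw [div_mul_eq_mul_div, ← map_mul, hc, map_mul, mul_div_cancel_left₀ _ haK]
    obtain ⟨c, hc⟩ := (FractionalIdeal.mem_one_iff _).mp this
    have hsx : s * x = c * a := IsFractionRing.injective D K (by
      rw [map_mul, map_mul, hc]
      field_simp)
    rw [hsx]
    exact I.mul_mem_left _ (hFI ha)

theorem valuationRing_localization {P : Ideal D} [hP : P.IsPrime]
    (h : ∀ a b : D, ∃ u w : D, u * b = w * a ∧ (u ∉ P ∨ w ∉ P)) :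
    ValuationRing (Localization.AtPrime P) := by
  have hunit (u : D) (hu : u ∉ P) : IsUnit (algebraMap D (Localization.AtPrime P) u) :=
    IsLocalization.map_units (Localization.AtPrime P) (⟨u, hu⟩ : P.primeCompl)
  refine ValuationRing.iff_dvd_total.mpr ⟨fun x y => ?_⟩
  obtain ⟨⟨a, s⟩, hx⟩ := IsLocalization.surj P.primeCompl x
  obtain ⟨⟨b, t⟩, hy⟩ := IsLocalization.surj P.primeCompl y
  have hs := hunit s s.2
  have ht := hunit t t.2
  obtain ⟨u, w, huw, hu⟩ := h a b
  have huw' := congrArg (algebraMap D (Localization.AtPrime P)) huw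
  rw [map_mul, map_mul, ← hx, ← hy] at huw'
  rcases hu with hu | hu
  · left
    rw [← ht.dvd_mul_right, ← (hunit u hu).dvd_mul_left]
    exact ⟨algebraMap D _ w * algebraMap D _ s, by linear_combination huw'⟩
  · right
    rw [← hs.dvd_mul_right, ← (hunit w hu).dvd_mul_left]
    exact ⟨algebraMap D _ u * algebraMap D _ t, by linear_combination -huw'⟩

/-- Every nonzero ideal of a domain has a greatest common divisor. -/
def HasIdealGCDs (V : Type*) [CommRing V] : Prop :=
  ∀ A : Ideal V, A ≠ ⊥ → ∃ g : V, (∀ a ∈ A, g ∣ a) ∧ ∀ e : V, (∀ a ∈ A, e ∣ a) → e ∣ g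

theorem IsTSharp.exists_mul_of_localization (hD : IsTSharp D K) {P : Ideal D} [hP : P.IsPrime]
    (h : ∀ a b : D, ∃ u w : D, u * b = w * a ∧ (u ∉ P ∨ w ∉ P))
    (I A B : Ideal (Localization.AtPrime P)) (hI : I ≠ ⊥) (hA : A ≠ ⊥) (hB : B ≠ ⊥)
    (hAB : A * B ≤ I) :
    ∃ H J : Ideal (Localization.AtPrime P), I = H * J ∧ A ≤ H ∧ B ≤ J := by
  set V := Localization.AtPrime P
  have hcomap {L : Ideal V} : (L.comap (algebraMap D V)).map (algebraMap D V) = L :=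
    IsLocalization.map_under P.primeCompl V L
  have hne {L : Ideal V} (hL : L ≠ ⊥) : L.comap (algebraMap D V) ≠ ⊥ := fun h0 => hL <| by
    rw [← hcomap (L := L), h0, Ideal.map_bot]
  have hle {L N : Ideal D}
      (hLN : (L : FractionalIdeal D⁰ K) ≤ tClosure (N : FractionalIdeal D⁰ K)) :
      L.map (algebraMap D V) ≤ N.map (algebraMap D V) := Ideal.map_le_iff_le_comap.mpr fun x hx => by
    obtain ⟨s, hs, hsx⟩ := exists_mul_mem_of_mem_tClosure hP h
      (hLN (FractionalIdeal.mem_coeIdeal_of_mem D⁰ hx))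
    have := Ideal.mem_map_of_mem (algebraMap D V) hsx
    rw [map_mul] at this
    exact (Ideal.unit_mul_mem_iff_mem _
      (IsLocalization.map_units V (⟨s, hs⟩ : P.primeCompl))).mp this
  obtain ⟨H, J, -, -, hHJ, hAH, hBJ⟩ := hD (I.comap (algebraMap D V)) (A.comap (algebraMap D V))
    (B.comap (algebraMap D V)) (hne hI) (hne hA) (hne hB)
    ((Ideal.le_comap_mul _).trans (Ideal.comap_mono hAB))
  refine ⟨H.map (algebraMap D V), J.map (algebraMap D V), ?_, ?_, ?_⟩
  · rw [← Ideal.map_mul]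
    refine le_antisymm ?_ ?_
    · have := hle (hHJ ▸ le_tClosure _)
      rwa [hcomap] at this
    · have := hle (L := H * J) (N := I.comap (algebraMap D V)) (hHJ.symm ▸ le_tClosure _)
      rwa [hcomap] at this
  · have := hle hAH
    rwa [hcomap] at this
  · have := hle hBJ
    rwa [hcomap] at this

theorem hasIdealGCDs_of_exists_mul {V : Type*} [CommRing V] [IsDomain V] [ValuationRing V]
    (h : ∀ I A B : Ideal V, I ≠ ⊥ → A ≠ ⊥ → B ≠ ⊥ → A * B ≤ I →
      ∃ H J : Ideal V, I = H * J ∧ A ≤ H ∧ B ≤ J) : HasIdealGCDs V := by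
  intro A hA0
  obtain ⟨d, hdA, hd0⟩ := Submodule.exists_mem_ne_zero_of_ne_bot hA0
  set B : Ideal V := (Ideal.span {d}).colon (A : Set V) with hB
  have hB0 : B ≠ ⊥ := by
    refine (Submodule.ne_bot_iff _).mpr ⟨d, ?_, hd0⟩
    exact Submodule.mem_colon.mpr fun s _ =>
      Ideal.mul_mem_right _ _ (Ideal.mem_span_singleton_self d)
  have hAB : A * B ≤ Ideal.span {d} := Ideal.mul_le.mpr fun a ha b hb => by
    rw [mul_comm]
    exact Submodule.mem_colon.mp hb a ha
  obtain ⟨H, J, hHJ, hAH, hBJ⟩ := h (Ideal.span {d}) A B (by simpa using hd0) hA0 hB0 hAB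
  have hdvd {x y : V} (hx : x ∈ H) (hy : y ∈ J) : d ∣ x * y :=
    Ideal.mem_span_singleton.mp (hHJ ▸ Ideal.mul_mem_mul hx hy)
  -- Otherwise `(d) = HJ ⊆ d𝔪`, which is absurd. Thus `(d) = (gj)`, and `g` is the gcd: cancel `j`
  -- in `gj ∣ aj`, and cancel `f` in `ef ∣ gf` where `d = ef`.
  obtain ⟨g, hg, j, hj, hgj⟩ : ∃ g ∈ H, ∃ j ∈ J, g * j ∣ d := by
    by_contra! hcon
    have hle : H * J ≤ Ideal.span {d} * IsLocalRing.maximalIdeal V :=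
      Ideal.mul_le.mpr fun x hx y hy => by
        obtain ⟨c, hc⟩ := hdvd hx hy
        rw [hc]
        refine Ideal.mul_mem_mul (Ideal.mem_span_singleton_self d) fun hu => ?_
        exact hcon x hx y hy (hc ▸ (hu.mul_right_dvd.mpr dvd_rfl))
    obtain ⟨c, hc, hdc⟩ := Ideal.mem_span_singleton_mul.mp
      (hle (hHJ ▸ Ideal.mem_span_singleton_self d))
    have : c = 1 := mul_left_cancel₀ hd0 (by rw [hdc, mul_one])
    exact hc (this ▸ isUnit_one)
  have hj0 : j ≠ 0 := by
    rintro rfl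
    rw [mul_zero, zero_dvd_iff] at hgj
    exact hd0 hgj
  refine ⟨g, fun a ha => ?_, fun e he => ?_⟩
  · exact (mul_dvd_mul_iff_right hj0).mp (hgj.trans (hdvd (hAH ha) hj))
  · obtain ⟨f, hf⟩ := he d hdA
    have hf0 : f ≠ 0 := by
      rintro rfl
      exact hd0 (by rw [hf, mul_zero])
    have hfB : f ∈ B := Submodule.mem_colon.mpr fun a ha => by
      rw [Ideal.mem_span_singleton, hf, smul_eq_mul, mul_comm]
      exact mul_dvd_mul_left f (he a ha)
    have := hdvd hg (hBJ hfB)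
    rw [hf] at this
    exact (mul_dvd_mul_iff_right hf0).mp this

/-- A valuation domain with greatest common divisors of nonzero ideals has no nonzero prime ideal
besides the maximal one. -/
theorem HasIdealGCDs.isUnit_of_notMem {V : Type*} [CommRing V] [IsDomain V] [ValuationRing V]
    (hV : HasIdealGCDs V) {Q : Ideal V} (hQ : Q.IsPrime) (hQ0 : Q ≠ ⊥) {y : V} (hy : y ∉ Q) :
    IsUnit y := by
  obtain ⟨x, hxQ, hx0⟩ := Submodule.exists_mem_ne_zero_of_ne_bot hQ0
  have hpow (n : ℕ) : ¬ x ∣ y ^ n := fun hn =>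
    hy (hQ.mem_of_pow_mem n (Ideal.mem_of_dvd Q hn hxQ))
  have hxy {n : ℕ} : y ^ n ∣ x := (ValuationRing.dvd_total x (y ^ n)).resolve_left (hpow n)
  -- These generators are stable under division by `y`, and each is divisible by `y` since `x`
  -- divides no power of `y`. So `gy` also divides `A`, whence `gy ∣ g`.
  set A : Ideal V := Ideal.span {c | ∃ n : ℕ, x ∣ c * y ^ n} with hA
  have hxA : x ∈ A := Ideal.subset_span ⟨0, by simp⟩
  have hA0 : A ≠ ⊥ := (Submodule.ne_bot_iff _).mpr ⟨x, hxA, hx0⟩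
  obtain ⟨g, hgA, hg⟩ := hV A hA0
  have hg0 : g ≠ 0 := by
    rintro rfl
    exact hx0 (zero_dvd_iff.mp (hgA x hxA))
  have hy0 : y ≠ 0 := fun h0 => hy (h0 ▸ Q.zero_mem)
  have hgy : g * y ∣ g := by
    refine hg _ fun a ha => ?_
    rw [← Ideal.mem_span_singleton]
    refine (Ideal.span_le (I := Ideal.span {g * y})).mpr ?_ ha
    rintro c ⟨n, hn⟩
    refine Ideal.mem_span_singleton.mpr ?_
    rcases ValuationRing.dvd_total c y with ⟨e, he⟩ | ⟨e, he⟩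
    · exact absurd (hn.trans ⟨e, by rw [pow_succ]; nth_rw 2 [he]; ring⟩) (hpow (n + 1))
    · rw [he, mul_comm g]
      refine mul_dvd_mul_left y (hgA e (Ideal.subset_span ⟨n + 1, ?_⟩))
      rw [he] at hn
      convert hn using 1
      ring
  exact isUnit_of_dvd_one ((mul_dvd_mul_iff_left hg0).mp (by rwa [mul_one]))

end Localization

/-! ### Ordered groups with suprema. -/

section CompleteGroups

/-- If all multiples of `y > 0` stay below `x`, then subtracting `y` from their supremum leaves an
upper bound. The shift by `x` makes the set nonpositive. -/
theorem archimedean_of_exists_isLUB {G : Type*} [AddCommGroup G] [LinearOrder G]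
    [IsOrderedAddMonoid G]
    (h : ∀ S : Set G, S.Nonempty → (∀ s ∈ S, s ≤ 0) → ∃ g, IsLUB S g) : Archimedean G := by
  refine ⟨fun x y hy => ?_⟩
  by_contra! hcon
  obtain ⟨g, hg⟩ := h (Set.range fun n : ℕ => n • y - x) (Set.range_nonempty _) (by
    rintro _ ⟨n, rfl⟩
    exact sub_nonpos.mpr (hcon n).le)
  have hub : g - y ∈ upperBounds (Set.range fun n : ℕ => n • y - x) := by
    rintro _ ⟨n, rfl⟩
    have := hg.1 ⟨n + 1, rfl⟩
    simp only [succ_nsmul] at this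
    rw [le_sub_iff_add_le, sub_add_eq_add_sub]
    exact this
  have := hg.2 hub
  rw [le_sub_self_iff] at this
  exact absurd hy this.not_gt

/-- A linearly ordered group in which nonempty sets of nonpositive elements have suprema is a
complete subgroup of the reals. -/
theorem exists_isComplete_addSubgroup {G : Type*} [AddCommGroup G] [LinearOrder G]
    [IsOrderedAddMonoid G]
    (h : ∀ S : Set G, S.Nonempty → (∀ s ∈ S, s ≤ 0) → ∃ g, IsLUB S g) :
    ∃ H : AddSubgroup ℝ, IsComplete (H : Set ℝ) ∧ Nonempty (G ≃+o H) := by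
  have := archimedean_of_exists_isLUB h
  obtain ⟨f, hf⟩ := Archimedean.exists_orderAddMonoidHom_real_injective G
  have hmono : StrictMono f := (OrderHomClass.mono f).strictMono_of_injective hf
  refine ⟨f.toAddMonoidHom.range, ?_, ⟨⟨AddMonoidHom.ofInjective hf, ?_⟩⟩⟩
  · refine IsClosed.isComplete ?_
    rcases AddSubgroup.dense_or_cyclic f.toAddMonoidHom.range with hd | ⟨a, ha⟩
    · suffices (f.toAddMonoidHom.range : Set ℝ) = Set.univ by rw [this]; exact isClosed_univ
      have hbetween {a b : ℝ} (hab : a < b) : ∃ g, a < f g ∧ f g < b := by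
        obtain ⟨_, ⟨g, rfl⟩, h1, h2⟩ := hd.exists_between hab
        exact ⟨g, h1, h2⟩
      -- Suprema are available only for nonpositive sets; negation covers the other half.
      have hneg {x : ℝ} (hx : x ≤ 0) : ∃ g, f g = x := by
        obtain ⟨g₀, -, hg₀⟩ := hbetween (sub_one_lt x)
        obtain ⟨g, hg⟩ := h {g | f g < x} ⟨g₀, hg₀⟩ fun s hs =>
          (hmono.lt_iff_lt.mp (by rw [map_zero]; exact lt_of_lt_of_le hs hx)).le
        refine ⟨g, le_antisymm (not_lt.mp fun hlt => ?_) (not_lt.mp fun hlt => ?_)⟩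
        · obtain ⟨k, hk1, hk2⟩ := hbetween hlt
          refine absurd (hg.2 fun s hs => ?_) (hmono.lt_iff_lt.mp hk2).not_ge
          exact (hmono.lt_iff_lt.mp (lt_trans hs hk1)).le
        · obtain ⟨k, hk1, hk2⟩ := hbetween hlt
          exact (hg.1 hk2).not_gt (hmono.lt_iff_lt.mp hk1)
      refine Set.eq_univ_of_forall fun x => ?_
      rcases le_total x 0 with hx | hx
      · exact hneg hx
      · obtain ⟨g, hg⟩ := hneg (neg_nonpos.mpr hx)
        exact ⟨-g, by change f (-g) = x; rw [map_neg, hg, neg_neg]⟩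
    · rw [ha, ← AddSubgroup.zmultiples_eq_closure]
      exact AddSubgroup.isClosed_of_discrete
  · intro a b
    exact hmono.le_iff_le

end CompleteGroups

/-! ### The value group and the conclusion. -/

theorem HasIdealGCDs.hasCompleteRealValueGroup {V : Type*} [CommRing V] [IsDomain V]
    [ValuationRing V] (hV : HasIdealGCDs V) : HasCompleteRealValueGroup V := by
  set F := FractionRing V
  set Γ := ValuationRing.ValueGroup V F
  set v := ValuationRing.valuation V F
  have hle (a b : V) : v (algebraMap V F a) ≤ v (algebraMap V F b) ↔ b ∣ a := by
    refine ⟨?_, ?_⟩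
    · rintro ⟨c, hc⟩
      refine ⟨c, IsFractionRing.injective V F ?_⟩
      rw [map_mul, ← hc, Algebra.smul_def, mul_comm]
    · rintro ⟨c, rfl⟩
      exact ⟨c, by rw [Algebra.smul_def, map_mul, mul_comm]⟩
  have hne {a : V} (ha : a ≠ 0) : v (algebraMap V F a) ≠ 0 :=
    (Valuation.ne_zero_iff v).mpr ((map_ne_zero_iff _ (IsFractionRing.injective V F)).mpr ha)
  have hsurj (w : Γ) (hw : w ≤ 1) : ∃ a : V, v (algebraMap V F a) = w := by
    induction w using Quotient.inductionOn' with
    | h x =>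
      obtain ⟨a, ha⟩ := (ValuationRing.mem_integer_iff V F x).mp hw
      exact ⟨a, by rw [ha]; rfl⟩
  have hle1 (a : V) : v (algebraMap V F a) ≤ 1 := by
    have := (hle a 1).mpr (one_dvd a)
    rwa [map_one, map_one] at this
  obtain ⟨H, hH, ⟨e⟩⟩ := exists_isComplete_addSubgroup (G := Additive Γˣ) fun S hS hS0 => by
    -- In this order `v a ≤ v b` means `b ∣ a`, so a gcd of `A` has value `sup S`.
    set A : Ideal V := Ideal.span {a | ∃ s ∈ S, v (algebraMap V F a) ≤ (s.toMul : Γˣ)} with hA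
    have hS1 {s : Additive Γˣ} (hs : s ∈ S) : ((s.toMul : Γˣ) : Γ) ≤ 1 := hS0 s hs
    have hmem {s : Additive Γˣ} (hs : s ∈ S) :
        ∃ a ∈ A, v (algebraMap V F a) = (s.toMul : Γˣ) := by
      obtain ⟨a, ha⟩ := hsurj _ (hS1 hs)
      exact ⟨a, Ideal.subset_span ⟨s, hs, ha.le⟩, ha⟩
    obtain ⟨s₀, hs₀⟩ := hS
    obtain ⟨a₀, ha₀, hva₀⟩ := hmem hs₀
    have ha₀0 : a₀ ≠ 0 := by
      rintro rfl
      rw [map_zero, map_zero] at hva₀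
      exact s₀.toMul.ne_zero hva₀.symm
    obtain ⟨g, hgA, hg⟩ := hV A ((Submodule.ne_bot_iff _).mpr ⟨a₀, ha₀, ha₀0⟩)
    have hg0 : g ≠ 0 := by
      rintro rfl
      exact ha₀0 (zero_dvd_iff.mp (hgA _ ha₀))
    refine ⟨Additive.ofMul (Units.mk0 _ (hne hg0)), fun s hs => ?_, fun u hu => ?_⟩
    · obtain ⟨a, ha, hva⟩ := hmem hs
      change ((s.toMul : Γˣ) : Γ) ≤ v (algebraMap V F g)
      rw [← hva]
      exact (hle a g).mpr (hgA a ha)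
    · change v (algebraMap V F g) ≤ ((u.toMul : Γˣ) : Γ)
      -- Only values at most `1` come from elements of `V`; a bound above `1` is trivial.
      rcases le_total 1 ((u.toMul : Γˣ) : Γ) with h1 | h1
      · exact (hle1 g).trans h1
      · obtain ⟨e, he⟩ := hsurj _ h1
        rw [← he]
        refine (hle g e).mpr (hg e fun a ha => ?_)
        rw [← Ideal.mem_span_singleton]
        refine (Ideal.span_le (I := Ideal.span {e})).mpr ?_ ha
        rintro c ⟨s, hs, hc⟩
        refine Ideal.mem_span_singleton.mpr ((hle c e).mp (hc.trans ?_))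
        rw [he]
        exact hu hs
  exact ⟨H, hH, ⟨⟨AddEquiv.toMultiplicativeRight e.toAddEquiv, e.map_le_map_iff'⟩⟩⟩

theorem IsTSharp.valuationRing_and_hasIdealGCDs {D : Type*} [CommRing D] [IsDomain D] {K : Type*}
    [Field K] [Algebra D K] [IsFractionRing D K] (hD : IsTSharp D K) {P : Ideal D} [hP : P.IsPrime]
    (hPt : IsTIdeal K P) :
    ValuationRing (Localization.AtPrime P) ∧ HasIdealGCDs (Localization.AtPrime P) := by
  have h := hD.isPVMD.exists_mul_eq_mul hP hPt
  have hV := valuationRing_localization h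
  exact ⟨hV, hasIdealGCDs_of_exists_mul (hD.exists_mul_of_localization h)⟩

/-- `Q` would extend to a nonzero nonmaximal prime of `D_P`, which the gcds exclude. -/
theorem IsTSharp.not_lt_of_isTIdeal {D : Type*} [CommRing D] [IsDomain D] {K : Type*} [Field K]
    [Algebra D K] [IsFractionRing D K] (hD : IsTSharp D K) {Q P : Ideal D} (hQ : Q.IsPrime)
    (hQ0 : Q ≠ ⊥) (hP : P.IsPrime) (hPt : IsTIdeal K P) : ¬ Q < P := by
  intro hQP
  obtain ⟨hV, hgcd⟩ := hD.valuationRing_and_hasIdealGCDs hPt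
  set V := Localization.AtPrime P
  have hdisj : Disjoint (P.primeCompl : Set D) (Q : Set D) :=
    Set.disjoint_left.mpr fun x hxP hxQ => hxP (hQP.le hxQ)
  have hQV : (Q.map (algebraMap D V)).IsPrime :=
    IsLocalization.isPrime_of_isPrime_disjoint P.primeCompl V Q hQ hdisj
  have hcomap : (Q.map (algebraMap D V)).comap (algebraMap D V) = Q :=
    IsLocalization.under_map_of_isPrime_disjoint P.primeCompl V hQ hdisj
  obtain ⟨y, hyP, hyQ⟩ := SetLike.exists_of_lt hQP
  have hunit : IsUnit (algebraMap D V y) := by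
    refine hgcd.isUnit_of_notMem hQV (fun h0 => hQ0 ?_) fun hy => hyQ (hcomap ▸ hy)
    rw [← hcomap, h0]
    exact Ideal.comap_bot_of_injective _
      (IsLocalization.injective V P.primeCompl_le_nonZeroDivisors)
  exact (IsLocalization.AtPrime.isUnit_to_map_iff V P y).mp hunit hyP

theorem mainTheorem7 {D : Type*} [CommRing D] [IsDomain D] (K : Type*) [Field K] [Algebra D K]
    [IsFractionRing D K] (hD : IsTSharp D K) :
    IsPVMD D K ∧ tDimension D K ≤ 1 ∧
      ∀ M : Ideal D, IsMaximalTIdeal K M →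
        ∃ (_ : M.IsPrime) (_ : ValuationRing (Localization.AtPrime M)),
          HasCompleteRealValueGroup (Localization.AtPrime M) := by
  refine ⟨hD.isPVMD, iSup₂_le fun n ⟨P, hmono, hP⟩ => ?_, fun M hM => ?_⟩
  · by_contra! hn
    have hn1 : 1 < n := by exact_mod_cast hn
    exact hD.not_lt_of_isTIdeal (hP ⟨0, by omega⟩).1 (hP ⟨0, by omega⟩).2.1 (hP ⟨1, hn1⟩).1
      (hP ⟨1, hn1⟩).2 (hmono (Fin.mk_lt_mk.mpr zero_lt_one))
  · have hMp := hM.isPrime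
    obtain ⟨hV, hgcd⟩ := hD.valuationRing_and_hasIdealGCDs hM.prop.1
    exact ⟨hMp, hV, hgcd.hasCompleteRealValueGroup⟩
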